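/- Let $e, k, n$ be integers with $n \geq 2$ and $1 \leq k \leq e-1$. Let $B^{\oplus k}(e,e,n)$ be the monoid presented by generators $\tilde t_i$ ($i \in \mathbb{Z}/e\mathbb{Z}$) and $\tilde s_3, \dots, \tilde s_n$ with relations \begin{itemize} \item $\tilde s_i \tilde s_j \tilde s_i = \tilde s_j \tilde s_i \tilde s_j$ for $|i-j| = 1$, and $\tilde s_i \tilde s_j = \tilde s_j \tilde s_i$ for $|i-j| > 1$, \item $\tilde s_3 \tilde t_i \tilde s_3 = \tilde t_i \tilde s_3 \tilde t_i$ for $i \in \mathbb{Z}/e\mathbb{Z}$ (when $n \geq 3$), \item $\tilde s_j \tilde t_i = \tilde t_i \tilde s_j$ for $i \in \mathbb{Z}/e\mathbb{Z}$ and $4 \leq j \leq n$, \item $\tilde t_i \tilde t_{i-k} = \tilde t_j \tilde t_{j-k}$ for $i, j \in \mathbb{Z}/e\mathbb{Z}$, \end{itemize} and let $B^{(k)}(e,e,n)$ be its group of fractions, that is, the group with the same presentation. Let $B(2,1,n-1)$ be the Artin–Tits group of type $B_{n-1}$: the group with generators $q_1, \dots, q_{n-1}$ and relations $q_1 q_2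 q_1 q_2 = q_2 q_1 q_2 q_1$, $q_j q_{j+1} q_j = q_{j+1} q_j q_{j+1}$ for $2 \leq j \leq n-2$, and $q_i q_j = q_j q_i$ for $|i-j| > 1$. Then $B(2,1,n-1)$ embeds in $B^{(k)}(e,e,n)$. More precisely, for every $i \in \mathbb{Z}/e\mathbb{Z}$ there is an injective group homomorphism $B(2,1,n-1) \to B^{(k)}(e,e,n)$ that sends $q_1$ to $\tilde t_i \tilde t_{i-k}$ and $q_j$ to $\tilde s_{j+1}$ for $2 \leq j \leq n-1$. -/

import Mathlib

namespace GarsideB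

/-! ### Groups of fractions of presented monoids -/

/-- The defining relators `u v⁻¹`, one for each relation `u = v` of a monoid presentation. -/
def relators {α : Type*} (rels : FreeMonoid α → FreeMonoid α → Prop) : Set (FreeGroup α) :=
  {r | ∃ u v : FreeMonoid α, rels u v ∧
    r = FreeMonoid.lift FreeGroup.of u * (FreeMonoid.lift FreeGroup.of v)⁻¹}

/-- The group with the same generators and relations as the monoid `PresentedMonoid rels`.
By `nonempty_mulEquiv_of_isGroupOfFractions` below this is the group of fractions of
`PresentedMonoid rels` as soon as the latter has one. -/
abbrev FracGroup {α : Type*} (rels : FreeMonoid α → FreeMonoid α → Prop) : Type _ :=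
  PresentedGroup (relators rels)

/-- The canonical homomorphism from a presented monoid to the group with the same presentation. -/
def toFrac {α : Type*} (rels : FreeMonoid α → FreeMonoid α → Prop) :
    PresentedMonoid rels →* FracGroup rels :=
  PresentedMonoid.lift (fun x => PresentedGroup.of x) (by
    intro a b hab
    have key : ∀ w : FreeMonoid α, FreeMonoid.lift
        (fun x => (PresentedGroup.of x : FracGroup rels)) w =
        PresentedGroup.mk (relators rels) (FreeMonoid.lift FreeGroup.of w) := by
      intro w
      have : FreeMonoid.lift (fun x => (PresentedGroup.of x : FracGroup rels)) =
        (PresentedGroup.mk (relators rels)).comp (FreeMonoid.lift FreeGroup.of) := by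
        ext x
        simp [PresentedGroup.of]
      rw [this]
      rfl
    rw [key, key, ← mul_inv_eq_one, ← map_inv, ← map_mul]
    exact PresentedGroup.one_of_mem ⟨a, b, hab, rfl⟩)

/-- `ι : M → G` exhibits the group `G` as the group of (right) fractions of the monoid `M`. -/
structure IsGroupOfFractions {M G : Type*} [Monoid M] [Group G] (ι : M →* G) : Prop where
  injective : Function.Injective ι
  exists_fraction : ∀ g : G, ∃ a b : M, g = ι a * (ι b)⁻¹

/-- Any group of fractions of a presented monoid is canonically isomorphic to the group with
the same presentation. -/
theorem nonempty_mulEquiv_of_isGroupOfFractions {α : Type*}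
    (rels : FreeMonoid α → FreeMonoid α → Prop) {G : Type*} [Group G]
    (ι : PresentedMonoid rels →* G) (hι : IsGroupOfFractions ι) :
    ∃ Φ : FracGroup rels ≃* G, ∀ a, Φ (toFrac rels a) = ι a := by
  let f : α → G := fun x => ι (PresentedMonoid.of rels x)
  have hf : ∀ w : FreeMonoid α,
      FreeGroup.lift f (FreeMonoid.lift FreeGroup.of w) = ι (PresentedMonoid.mk rels w) := by
    intro w
    have : (FreeGroup.lift f).comp (FreeMonoid.lift FreeGroup.of) =
        ι.comp (PresentedMonoid.mk rels) := by
      ext x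
      simp [f, PresentedMonoid.of]
    exact DFunLike.congr_fun this w
  have hrel : ∀ r ∈ relators rels, FreeGroup.lift f r = 1 := by
    rintro r ⟨u, v, huv, rfl⟩
    rw [map_mul, map_inv, hf, hf, mul_inv_eq_one]
    exact congrArg ι ((Con.eq (conGen rels)).2 (ConGen.Rel.of u v huv))
  let Φ : FracGroup rels →* G := PresentedGroup.toGroup hrel
  have hΦ : ∀ a, Φ (toFrac rels a) = ι a := by
    intro a
    have : Φ.comp (toFrac rels) = ι := by
      ext x
      simp [Φ, f, toFrac]
    exact DFunLike.congr_fun this a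
  have ore : ∀ a b : PresentedMonoid rels, ∃ c d : PresentedMonoid rels,
      (toFrac rels b)⁻¹ * toFrac rels a = toFrac rels c * (toFrac rels d)⁻¹ := by
    intro a b
    obtain ⟨c, d, h⟩ := hι.exists_fraction ((ι b)⁻¹ * ι a)
    refine ⟨c, d, ?_⟩
    have h1 : a * d = b * c := hι.injective (by
      rw [map_mul, map_mul, mul_inv_eq_iff_eq_mul.mp h.symm]
      group)
    have h2 := congrArg (toFrac rels) h1
    rw [map_mul, map_mul] at h2
    rw [inv_mul_eq_iff_eq_mul, ← mul_assoc, ← h2, mul_inv_cancel_right]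
  let H : Subgroup (FracGroup rels) :=
    { carrier := {g | ∃ a b, g = toFrac rels a * (toFrac rels b)⁻¹}
      one_mem' := ⟨1, 1, by simp⟩
      mul_mem' := by
        rintro _ _ ⟨a, b, rfl⟩ ⟨a', b', rfl⟩
        obtain ⟨c, d, h⟩ := ore a' b
        refine ⟨a * c, b' * d, ?_⟩
        calc toFrac rels a * (toFrac rels b)⁻¹ * (toFrac rels a' * (toFrac rels b')⁻¹)
            = toFrac rels a * ((toFrac rels b)⁻¹ * toFrac rels a') * (toFrac rels b')⁻¹ := by
              group
          _ = _ := by rw [h, map_mul, map_mul]; group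
      inv_mem' := by
        rintro _ ⟨a, b, rfl⟩
        exact ⟨b, a, by simp⟩ }
  have hH : ∀ g : FracGroup rels, g ∈ H :=
    PresentedGroup.generated_by _ H
      fun x => ⟨PresentedMonoid.of rels x, 1, by rw [map_one, inv_one, mul_one]; rfl⟩
  refine ⟨MulEquiv.ofBijective Φ ⟨?_, ?_⟩, hΦ⟩
  · rw [injective_iff_map_eq_one]
    intro g hg
    obtain ⟨a, b, rfl⟩ := hH g
    rw [map_mul, map_inv, hΦ, hΦ, mul_inv_eq_one] at hg
    rw [hι.injective hg, mul_inv_cancel]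
  · intro g
    obtain ⟨a, b, rfl⟩ := hι.exists_fraction g
    exact ⟨toFrac rels a * (toFrac rels b)⁻¹, by rw [map_mul, map_inv, hΦ, hΦ]⟩

/-! ### The monoid and the group `B^{(k)}(e,e,n)` -/

/-- The generators `t̃_i` (`i ∈ ℤ/eℤ`) and `s̃_j` (`3 ≤ j ≤ n`). -/
inductive KGen (e n : ℕ) : Type
  | t (i : ZMod e) : KGen e n
  | s (j : Set.Icc 3 n) : KGen e n

/-- The defining relations of the monoid `B^{⊕k}(e,e,n)`. -/
inductive KRel (e k n : ℕ) : FreeMonoid (KGen e n) → FreeMonoid (KGen e n) → Prop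
  | s_braid (i j : Set.Icc 3 n) (h : (i : ℕ) + 1 = j) :
      KRel e k n (.of (.s i) * .of (.s j) * .of (.s i)) (.of (.s j) * .of (.s i) * .of (.s j))
  | s_comm (i j : Set.Icc 3 n) (h : (i : ℕ) + 1 < j) :
      KRel e k n (.of (.s i) * .of (.s j)) (.of (.s j) * .of (.s i))
  | st_braid (j : Set.Icc 3 n) (h : (j : ℕ) = 3) (i : ZMod e) :
      KRel e k n (.of (.s j) * .of (.t i) * .of (.s j)) (.of (.t i) * .of (.s j) * .of (.t i))
  | st_comm (j : Set.Icc 3 n) (h : 4 ≤ (j : ℕ)) (i : ZMod e) :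
      KRel e k n (.of (.s j) * .of (.t i)) (.of (.t i) * .of (.s j))
  | t_dual (i j : ZMod e) :
      KRel e k n (.of (.t i) * .of (.t (i - (k : ZMod e))))
        (.of (.t j) * .of (.t (j - (k : ZMod e))))

/-- The monoid `B^{⊕k}(e,e,n)`. -/
abbrev KMonoid (e k n : ℕ) : Type := PresentedMonoid (KRel e k n)

/-- The group `B^{(k)}(e,e,n)`, the group of fractions of `B^{⊕k}(e,e,n)`. -/
abbrev KGroup (e k n : ℕ) : Type := FracGroup (KRel e k n)

/-- The element `t̃_i` of `B^{(k)}(e,e,n)`. -/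
def KGroup.t {e k n : ℕ} (i : ZMod e) : KGroup e k n := PresentedGroup.of (KGen.t i)

/-- The element `s̃_j` of `B^{(k)}(e,e,n)`, for `3 ≤ j ≤ n`. -/
def KGroup.s {e k n : ℕ} (j : Set.Icc 3 n) : KGroup e k n := PresentedGroup.of (KGen.s j)

/-! ### The Artin–Tits group `B(2,1,m)` of type `B_m` -/

/-- The relations of the Artin–Tits monoid on `q_1, …, q_m` whose diagram is a chain with a double
edge between `q_1` and `q_2` and simple edges otherwise. -/
inductive ARel (m : ℕ) : FreeMonoid (Set.Icc 1 m) → FreeMonoid (Set.Icc 1 m) → Prop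
  | braid_four (i j : Set.Icc 1 m) (hi : (i : ℕ) = 1) (hj : (j : ℕ) = 2) :
      ARel m (.of i * .of j * .of i * .of j) (.of j * .of i * .of j * .of i)
  | braid_three (i j : Set.Icc 1 m) (hi : 2 ≤ (i : ℕ)) (hj : (i : ℕ) + 1 = j) :
      ARel m (.of i * .of j * .of i) (.of j * .of i * .of j)
  | comm (i j : Set.Icc 1 m) (h : (i : ℕ) + 1 < j) :
      ARel m (.of i * .of j) (.of j * .of i)

/-- The Artin–Tits monoid of type `B_m`. -/
abbrev ArtinMonoidB (m : ℕ) : Type := PresentedMonoid (ARel m)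

/-- The Artin–Tits group `B(2,1,m)` of type `B_m`. -/
abbrev ArtinGroupB (m : ℕ) : Type := FracGroup (ARel m)

/-- The generator `q_j` of `B(2,1,m)`, for `1 ≤ j ≤ m`. -/
def ArtinGroupB.q {m : ℕ} (j : Set.Icc 1 m) : ArtinGroupB m := PresentedGroup.of j

end GarsideB

namespace GarsideB

/-! ### The relations of type `B_m` in a group -/

/-! Sending every `t̃_i` to `σ_1` and `s̃_j` to `σ_{j-1}` maps `B^{(k)}(e,e,n)` onto the braid group
on `n` strands; the candidate embedding then becomes `q_1 ↦ σ_1²`, `q_j ↦ σ_j`. Classically this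
identifies the Artin group `G` of type `B_{n-1}` with the stabilizer of a strand, a subgroup of
index `n`. That fact is not assumed. Instead the action of the braid group on itself, split along
the `n` cosets of `G`, is written down as permutations of `G × {0, …, n-1}` (`cosetPerm`). The
relations of type `B` suffice to verify the braid relations (`IsArtinB.cosetPerm_comm`,
`IsArtinB.cosetPerm_braid`). On the coset of index `0`, `G` acts by left translation, which is
faithful, so the composite and hence the candidate are injective. That the candidate is well defined
rests on `KGroup.braid_four`. -/

/-- The elements `q 1, …, q m` of a group satisfy the Artin relations of type `B_m`; the
commutation relations are imposed on the whole sequence. -/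
structure IsArtinB {G : Type*} [Group G] (m : ℕ) (q : ℕ → G) : Prop where
  braid_four : q 1 * q 2 * q 1 * q 2 = q 2 * q 1 * q 2 * q 1
  braid_three : ∀ i, 2 ≤ i → i + 1 ≤ m → q i * q (i + 1) * q i = q (i + 1) * q i * q (i + 1)
  comm : ∀ i j, i + 1 < j → Commute (q i) (q j)

/-- The conjugates `q_j ⋯ q_2 q_1 q_2⁻¹ ⋯ q_j⁻¹` of `q_1`. -/
def twist {G : Type*} [Group G] (q : ℕ → G) : ℕ → G
  | 0 => 1
  | 1 => q 1
  | j + 2 => q (j + 2) * twist q (j + 1) * (q (j + 2))⁻¹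

section Twist

variable {G : Type*} [Group G] {m : ℕ} {q : ℕ → G}

theorem twist_succ {j : ℕ} (hj : 1 ≤ j) :
    twist q (j + 1) = q (j + 1) * twist q j * (q (j + 1))⁻¹ := by
  obtain ⟨j, rfl⟩ := Nat.exists_eq_add_of_le' hj
  rfl

theorem twist_succ_mul {j : ℕ} (hj : 1 ≤ j) :
    twist q (j + 1) * q (j + 1) = q (j + 1) * twist q j := by
  rw [twist_succ hj, inv_mul_cancel_right]

theorem IsArtinB.commute_twist_of_lt (hq : IsArtinB m q) {i : ℕ} (hi : 1 ≤ i) :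
    ∀ l, i + 1 < l → Commute (twist q i) (q l) := by
  induction i, hi using Nat.le_induction with
  | base => exact fun l hl => hq.comm 1 l hl
  | succ i hi ih =>
    intro l hl
    rw [twist_succ hi]
    have h := hq.comm (i + 1) l hl
    exact (h.mul_left (ih l (by omega))).mul_left h.inv_left

/-- When `l = r + 1`, the braid relation shows that conjugation by `q l * q r` sends `q l` to `q r`.
It also sends `twist q (r - 1)`, which commutes with `q l`, to `twist q l`. Larger `l` only
conjugate by elements commuting with `q r`. -/
theorem IsArtinB.commute_twist_of_gt (hq : IsArtinB m q) {r l : ℕ} (hr : 2 ≤ r)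
    (hrl : r + 1 ≤ l) : l ≤ m → Commute (twist q l) (q r) := by
  induction l, hrl using Nat.le_induction with
  | base =>
    intro hl
    obtain ⟨r, rfl⟩ := Nat.exists_eq_add_of_le' (show 1 ≤ r by omega)
    have hb := hq.braid_three (r + 1) hr hl
    have hc := hq.commute_twist_of_lt (i := r) (by omega) (r + 1 + 1) (by omega)
    rw [twist_succ (by omega), twist_succ (by omega)]
    generalize q (r + 1) = x at *
    generalize q (r + 1 + 1) = y at *
    generalize twist q r = a at *
    have hx : x = (y * x) * y * (y * x)⁻¹ := by
      rw [eq_mul_inv_iff_mul_eq, ← mul_assoc, hb]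
    have h : y * (x * a * x⁻¹) * y⁻¹ = (y * x) * a * (y * x)⁻¹ := by group
    rw [h]
    nth_rw 3 [hx]
    exact (SemiconjBy.conj_iff).2 hc
  | succ l hl ih =>
    intro hlm
    rw [twist_succ (by omega)]
    have h := (hq.comm r (l + 1) (by omega)).symm
    exact (h.mul_left (ih (by omega))).mul_left h.inv_left

/-- Conjugation by `q (i + 1) * q (i + 2)` carries the pair `twist q i`, `q (i + 1)` to the pair
`twist q (i + 1)`, `q (i + 2)`, so the relation propagates from `i = 1`. -/
theorem IsArtinB.twist_braid_four (hq : IsArtinB m q) {i : ℕ} (hi : 1 ≤ i) : i + 1 ≤ m →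
    twist q i * q (i + 1) * twist q i * q (i + 1) =
      q (i + 1) * twist q i * q (i + 1) * twist q i := by
  induction i, hi using Nat.le_induction with
  | base => exact fun _ => hq.braid_four
  | succ i hi ih =>
    intro him
    have h4 := ih (by omega)
    have hb := hq.braid_three (i + 1) (by omega) him
    have hc := (hq.commute_twist_of_lt hi (i + 1 + 1) (by omega)).eq
    rw [twist_succ hi]
    generalize q (i + 1) = x at *
    generalize q (i + 1 + 1) = y at *
    generalize twist q i = a at *
    have ha : MulAut.conj (x * y) a = x * a * x⁻¹ := by
      rw [MulAut.conj_apply, mul_assoc x, ← hc]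
      group
    have hx : MulAut.conj (x * y) x = y := by
      rw [MulAut.conj_apply, mul_inv_eq_iff_eq_mul, hb, mul_assoc]
    generalize MulAut.conj (x * y) = f at *
    have h := congrArg f h4
    simpa only [map_mul, ha, hx] using h

end Twist

/-! ### The action on the cosets of the stabilizer of a strand -/

/-- The action of the standard generator of index `i` of the braid group on `m + 1` strands on
`G × {0, …, m}`, where `G` is the Artin group of type `B_m` viewed as the stabilizer of a strand,
with the coset of index `j` represented by the product of the generators of index `j, …, 1`. -/
def cosetPerm {G : Type*} [Group G] (m : ℕ) (q : ℕ → G) (i : ℕ) : Equiv.Perm (G × ℕ) where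
  toFun x :=
    if m < x.2 ∨ m < i then x
    else if x.2 + 1 < i then (q i * x.1, x.2)
    else if x.2 + 1 = i then (x.1, x.2 + 1)
    -- In the braid group, `σ_i² (σ_{i-1} ⋯ σ_1) = (σ_{i-1} ⋯ σ_1) (σ_i ⋯ σ_2 σ_1² σ_2⁻¹ ⋯ σ_i⁻¹)`.
    else if x.2 = i then (twist q i * x.1, x.2 - 1)
    -- For `i < j`, moving `σ_i` rightwards past `σ_j ⋯ σ_1` turns it into `σ_{i+1}`.
    else (q (i + 1) * x.1, x.2)
  invFun x :=
    if m < x.2 ∨ m < i then x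
    else if x.2 + 1 < i then ((q i)⁻¹ * x.1, x.2)
    else if x.2 + 1 = i then ((twist q i)⁻¹ * x.1, x.2 + 1)
    else if x.2 = i then (x.1, x.2 - 1)
    else ((q (i + 1))⁻¹ * x.1, x.2)
  left_inv := by
    rintro ⟨h, j⟩
    by_cases hg : m < j ∨ m < i
    · simp [hg]
    rcases lt_trichotomy (j + 1) i with hj | rfl | hj
    · simp [hg, hj]
    · simp [show ¬ m < j + 1 by omega, show ¬ m < j by omega]
    rcases eq_or_lt_of_le (show i ≤ j by omega) with rfl | hj
    · rcases i with _ | i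
      -- At `i = j = 0` truncated subtraction fixes the index, and the default `twist q 0 = 1` makes
      -- the map the identity.
      · simp [twist]
      · simp [show ¬ m < i + 1 by omega, show ¬ m < i by omega]
    · simp [hg, show ¬ j + 1 < i by omega, show j + 1 ≠ i by omega, hj.ne']
  right_inv := by
    rintro ⟨h, j⟩
    by_cases hg : m < j ∨ m < i
    · simp [hg]
    rcases lt_trichotomy (j + 1) i with hj | rfl | hj
    · simp [hg, hj]
    · simp [show ¬ m < j + 1 by omega, show ¬ m < j by omega]
    rcases eq_or_lt_of_le (show i ≤ j by omega) with rfl | hj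
    · rcases i with _ | i
      · simp [twist]
      · simp [show ¬ m < i + 1 by omega, show ¬ m < i by omega]
    · simp [hg, show ¬ j + 1 < i by omega, show j + 1 ≠ i by omega, hj.ne']

section CosetPerm

variable {G : Type*} [Group G] {m : ℕ} {q : ℕ → G} {i j : ℕ} (h : G)

theorem cosetPerm_of_lt (hj : m < j) : cosetPerm m q i (h, j) = (h, j) :=
  if_pos (Or.inl hj)

theorem cosetPerm_of_add_one_lt (hi : i ≤ m) (hj : j + 1 < i) :
    cosetPerm m q i (h, j) = (q i * h, j) := by
  simp [cosetPerm, show ¬ (m < j ∨ m < i) by omega, hj]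

theorem cosetPerm_up (hj : j + 1 ≤ m) : cosetPerm m q (j + 1) (h, j) = (h, j + 1) := by
  simp [cosetPerm, show ¬ m < j by omega, show ¬ m < j + 1 by omega]

theorem cosetPerm_down (hj : j + 1 ≤ m) :
    cosetPerm m q (j + 1) (h, j + 1) = (twist q (j + 1) * h, j) := by
  simp [cosetPerm, show ¬ (m < j + 1) by omega]

theorem cosetPerm_of_gt (hj : j ≤ m) (hi : i < j) :
    cosetPerm m q i (h, j) = (q (i + 1) * h, j) := by
  simp [cosetPerm, show ¬ (m < j ∨ m < i) by omega, show ¬ (j + 1 < i) by omega,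
    show j + 1 ≠ i by omega, show j ≠ i by omega]

theorem IsArtinB.cosetPerm_comm (hq : IsArtinB m q) {i l : ℕ} (hi : 1 ≤ i) (hil : i + 1 < l)
    (hl : l ≤ m) : cosetPerm m q i * cosetPerm m q l = cosetPerm m q l * cosetPerm m q i := by
  obtain ⟨i, rfl⟩ := Nat.exists_eq_add_of_le' hi
  obtain ⟨l, rfl⟩ := Nat.exists_eq_add_of_le' (show 1 ≤ l by omega)
  ext1 ⟨h, j⟩
  simp only [Equiv.Perm.mul_apply]
  have key {a b : G} (hab : Commute a b) : a * (b * h) = b * (a * h) := hab.left_comm h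
  rcases lt_or_ge m j with hj | hj
  · simp only [cosetPerm_of_lt _ hj]
  rcases lt_trichotomy j i with hji | rfl | hji
  · simp (disch := omega) only [cosetPerm_of_add_one_lt, key (hq.comm _ _ hil)]
  · simp (disch := omega) only [cosetPerm_of_add_one_lt, cosetPerm_up]
  obtain rfl | hji := eq_or_lt_of_le (show i + 1 ≤ j from hji)
  · simp (disch := omega) only [cosetPerm_of_add_one_lt, cosetPerm_down,
      key (hq.commute_twist_of_lt hi _ hil)]
  rcases lt_trichotomy j l with hjl | rfl | hjl
  · simp (disch := omega) only [cosetPerm_of_add_one_lt, cosetPerm_of_gt,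
      key (hq.comm (i + 1 + 1) (l + 1) (by omega))]
  · simp (disch := omega) only [cosetPerm_up, cosetPerm_of_gt]
  obtain rfl | hjl := eq_or_lt_of_le (show l + 1 ≤ j from hjl)
  · simp (disch := omega) only [cosetPerm_down, cosetPerm_of_gt,
      key (hq.commute_twist_of_gt (r := i + 1 + 1) (by omega) (by omega) hl)]
  · simp (disch := omega) only [cosetPerm_of_gt, key (hq.comm (i + 1 + 1) (l + 1 + 1) (by omega))]

theorem IsArtinB.cosetPerm_braid (hq : IsArtinB m q) {i : ℕ} (hi : 1 ≤ i) (him : i + 1 ≤ m) :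
    cosetPerm m q i * cosetPerm m q (i + 1) * cosetPerm m q i =
      cosetPerm m q (i + 1) * cosetPerm m q i * cosetPerm m q (i + 1) := by
  obtain ⟨i, rfl⟩ := Nat.exists_eq_add_of_le' hi
  ext1 ⟨h, j⟩
  simp only [Equiv.Perm.mul_apply]
  have hb (r : ℕ) (hr : 2 ≤ r) (hrm : r + 1 ≤ m) :
      q r * (q (r + 1) * (q r * h)) = q (r + 1) * (q r * (q (r + 1) * h)) := by
    simp only [← mul_assoc, hq.braid_three r hr hrm]
  have ht : twist q (i + 1 + 1) * q (i + 1 + 1) = q (i + 1 + 1) * twist q (i + 1) :=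
    twist_succ_mul (by omega)
  rcases lt_or_ge m j with hj | hj
  · simp only [cosetPerm_of_lt _ hj]
  rcases lt_trichotomy j i with hji | rfl | hji
  · simp (disch := omega) only [cosetPerm_of_add_one_lt, hb (i + 1) (by omega) him]
  · simp (disch := omega) only [cosetPerm_of_add_one_lt, cosetPerm_up, cosetPerm_of_gt]
  obtain rfl | hji := eq_or_lt_of_le (show i + 1 ≤ j from hji)
  · simp (disch := omega) only [cosetPerm_of_add_one_lt, cosetPerm_up, cosetPerm_down,
      cosetPerm_of_gt, ← mul_assoc, ht]
  obtain rfl | hji := eq_or_lt_of_le (show i + 1 + 1 ≤ j from hji)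
  -- The only coset where the relation of length four enters: both generators move down through it,
  -- which leaves the identity `h5` between twists.
  · have h4 := hq.twist_braid_four hi him
    have h5 : twist q (i + 1) * twist q (i + 1 + 1) * q (i + 1 + 1) =
        q (i + 1 + 1) * twist q (i + 1) * twist q (i + 1 + 1) := by
      rw [mul_assoc, ht, twist_succ hi, ← mul_assoc, ← mul_assoc, ← mul_assoc, ← h4]
      group
    simp (disch := omega) only [cosetPerm_of_add_one_lt, cosetPerm_down, cosetPerm_of_gt,
      ← mul_assoc, h5]
  · simp (disch := omega) only [cosetPerm_of_gt, hb (i + 1 + 1) (by omega) (by omega)]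

end CosetPerm

/-! ### The embedding -/

theorem lift_relators_eq_one {α G : Type*} [Group G] {rels : FreeMonoid α → FreeMonoid α → Prop}
    (f : α → G) (hf : ∀ u v, rels u v → FreeMonoid.lift f u = FreeMonoid.lift f v) :
    ∀ r ∈ relators rels, FreeGroup.lift f r = 1 := by
  rintro r ⟨u, v, huv, rfl⟩
  have key : (FreeGroup.lift f).comp (FreeMonoid.lift FreeGroup.of) = FreeMonoid.lift f := by
    ext x
    simp
  have h := hf u v huv
  rw [← key] at h
  rw [map_mul, map_inv, mul_inv_eq_one]
  exact h

/-- The homomorphism out of `FracGroup rels` given by images of the generators satisfying the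
relations. -/
def FracGroup.lift {α G : Type*} [Group G] {rels : FreeMonoid α → FreeMonoid α → Prop}
    (f : α → G) (hf : ∀ u v, rels u v → FreeMonoid.lift f u = FreeMonoid.lift f v) :
    FracGroup rels →* G :=
  PresentedGroup.toGroup (lift_relators_eq_one f hf)

theorem FracGroup.lift_of {α G : Type*} [Group G] {rels : FreeMonoid α → FreeMonoid α → Prop}
    (f : α → G) (hf : ∀ u v, rels u v → FreeMonoid.lift f u = FreeMonoid.lift f v) (x : α) :
    FracGroup.lift f hf (PresentedGroup.of x) = f x :=
  PresentedGroup.toGroup.of _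

theorem FracGroup.lift_eq_lift {α : Type*} {rels : FreeMonoid α → FreeMonoid α → Prop}
    {u v : FreeMonoid α} (huv : rels u v) :
    FreeMonoid.lift (PresentedGroup.of (rels := relators rels)) u =
      FreeMonoid.lift (PresentedGroup.of (rels := relators rels)) v := by
  have key (w : FreeMonoid α) : toFrac rels (PresentedMonoid.mk rels w) =
      FreeMonoid.lift (PresentedGroup.of (rels := relators rels)) w := rfl
  rw [← key, ← key]
  exact congrArg _ ((Con.eq (conGen rels)).2 (ConGen.Rel.of u v huv))

/-- The generators of the Artin group of type `B_m`, extended by `1` to all indices. -/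
def ArtinGroupB.gen (m : ℕ) (j : ℕ) : ArtinGroupB m :=
  if h : j ∈ Set.Icc 1 m then ArtinGroupB.q ⟨j, h⟩ else 1

theorem ArtinGroupB.gen_coe {m : ℕ} (j : Set.Icc 1 m) :
    ArtinGroupB.gen m j = ArtinGroupB.q j :=
  dif_pos j.2

theorem ArtinGroupB.gen_eq_one {m j : ℕ} (h : j ∉ Set.Icc 1 m) : ArtinGroupB.gen m j = 1 :=
  dif_neg h

/-- The default value `1` makes the relations trivial as soon as they involve an index outside `1,
…, m`. -/
theorem ArtinGroupB.isArtinB_gen (m : ℕ) : IsArtinB m (ArtinGroupB.gen m) where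
  braid_four := by
    by_cases h : 2 ≤ m
    · have := FracGroup.lift_eq_lift (ARel.braid_four (m := m) ⟨1, by simp; omega⟩
        ⟨2, by simp; omega⟩ rfl rfl)
      simp only [map_mul, FreeMonoid.lift_eval_of] at this
      rw [← ArtinGroupB.q, ← ArtinGroupB.q, ← ArtinGroupB.gen_coe, ← ArtinGroupB.gen_coe] at this
      exact this
    · rw [ArtinGroupB.gen_eq_one (j := 2) (by simp; omega)]
      simp
  braid_three i h2 him := by
    have := FracGroup.lift_eq_lift (ARel.braid_three (m := m) ⟨i, by simp; omega⟩
      ⟨i + 1, by simp; omega⟩ h2 rfl)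
    simp only [map_mul, FreeMonoid.lift_eval_of] at this
    rw [← ArtinGroupB.q, ← ArtinGroupB.q, ← ArtinGroupB.gen_coe, ← ArtinGroupB.gen_coe] at this
    exact this
  comm i j hij := by
    by_cases hi : i ∈ Set.Icc 1 m
    · by_cases hj : j ∈ Set.Icc 1 m
      · have := FracGroup.lift_eq_lift (ARel.comm (m := m) ⟨i, hi⟩ ⟨j, hj⟩ hij)
        simp only [map_mul, FreeMonoid.lift_eval_of] at this
        rw [← ArtinGroupB.q, ← ArtinGroupB.q, ← ArtinGroupB.gen_coe, ← ArtinGroupB.gen_coe] at this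
        exact this
      · rw [ArtinGroupB.gen_eq_one hj]
        exact Commute.one_right _
    · rw [ArtinGroupB.gen_eq_one hi]
      exact Commute.one_left _

/-- The action of `B^{(k)}(e,e,n)` through the braid group on `n` strands, every `t̃_i` being sent
to the first standard generator. -/
def KGroup.toPerm (e k n : ℕ) : KGroup e k n →* Equiv.Perm (ArtinGroupB (n - 1) × ℕ) :=
  FracGroup.lift
    (fun x => match x with
      | .t _ => cosetPerm (n - 1) (ArtinGroupB.gen (n - 1)) 1
      | .s j => cosetPerm (n - 1) (ArtinGroupB.gen (n - 1)) (j - 1))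
    (by
      have hq := ArtinGroupB.isArtinB_gen (n - 1)
      -- Both sides of `t_dual` become the square of the first generator, so `simp only` closes that
      -- case.
      rintro _ _ (⟨⟨i, hi⟩, ⟨j, hj⟩, h⟩ | ⟨⟨i, hi⟩, ⟨j, hj⟩, h⟩ | ⟨⟨j, hj⟩, h, i⟩ | ⟨⟨j, hj⟩, h, i⟩ |
        ⟨i, j⟩) <;> simp only [map_mul, FreeMonoid.lift_eval_of]
      · obtain rfl : i + 1 = j := h
        have := hq.cosetPerm_braid (i := i - 1) (by grind) (by grind)
        rwa [show i - 1 + 1 = i + 1 - 1 by grind] at this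
      · exact hq.cosetPerm_comm (by grind) (by grind) (by grind)
      · obtain rfl : j = 3 := h
        exact (hq.cosetPerm_braid (i := 1) le_rfl (by grind)).symm
      · exact (hq.cosetPerm_comm le_rfl (by grind) (by grind)).symm)

theorem KGroup.toPerm_t {e k n : ℕ} (i : ZMod e) :
    KGroup.toPerm e k n (KGroup.t i) = cosetPerm (n - 1) (ArtinGroupB.gen (n - 1)) 1 :=
  FracGroup.lift_of _ _ _

theorem KGroup.toPerm_s {e k n : ℕ} (j : Set.Icc 3 n) :
    KGroup.toPerm e k n (KGroup.s j) = cosetPerm (n - 1) (ArtinGroupB.gen (n - 1)) (j - 1) :=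
  FracGroup.lift_of _ _ _

section KGroupRelations

variable {e k n : ℕ}

theorem KGroup.s_braid (i j : Set.Icc 3 n) (h : (i : ℕ) + 1 = j) :
    (KGroup.s i * KGroup.s j * KGroup.s i : KGroup e k n) =
      KGroup.s j * KGroup.s i * KGroup.s j :=
  FracGroup.lift_eq_lift (KRel.s_braid (e := e) (k := k) i j h)

theorem KGroup.s_comm (i j : Set.Icc 3 n) (h : (i : ℕ) + 1 < j) :
    (KGroup.s i * KGroup.s j : KGroup e k n) = KGroup.s j * KGroup.s i :=
  FracGroup.lift_eq_lift (KRel.s_comm (e := e) (k := k) i j h)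

theorem KGroup.st_braid (j : Set.Icc 3 n) (h : (j : ℕ) = 3) (i : ZMod e) :
    (KGroup.s j * KGroup.t i * KGroup.s j : KGroup e k n) =
      KGroup.t i * KGroup.s j * KGroup.t i :=
  FracGroup.lift_eq_lift (KRel.st_braid (k := k) j h i)

theorem KGroup.st_comm (j : Set.Icc 3 n) (h : 4 ≤ (j : ℕ)) (i : ZMod e) :
    (KGroup.s j * KGroup.t i : KGroup e k n) = KGroup.t i * KGroup.s j :=
  FracGroup.lift_eq_lift (KRel.st_comm (k := k) j h i)

theorem KGroup.t_dual (i j : ZMod e) :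
    (KGroup.t i * KGroup.t (i - (k : ZMod e)) : KGroup e k n) =
      KGroup.t j * KGroup.t (j - (k : ZMod e)) :=
  FracGroup.lift_eq_lift (KRel.t_dual (n := n) i j)

theorem KGroup.braid_four (j : Set.Icc 3 n) (h : (j : ℕ) = 3) (i : ZMod e) :
    (KGroup.t i * KGroup.t (i - (k : ZMod e)) * KGroup.s j *
      (KGroup.t i * KGroup.t (i - (k : ZMod e))) * KGroup.s j : KGroup e k n) =
    KGroup.s j * (KGroup.t i * KGroup.t (i - (k : ZMod e))) * KGroup.s j *
      (KGroup.t i * KGroup.t (i - (k : ZMod e))) := by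
  -- The auxiliary generator `x = t̃_{i+k}` gives a second factorization `x * t = t * u`. Switching
  -- between the two lets the braid relations with `s` carry it across.
  have hx := KGroup.st_braid (k := k) j h (i + (k : ZMod e))
  have ht := KGroup.st_braid (k := k) j h i
  have hu := KGroup.st_braid (k := k) j h (i - (k : ZMod e))
  have hT := KGroup.t_dual (k := k) (n := n) (i + (k : ZMod e)) i
  rw [add_sub_cancel_right] at hT
  generalize (KGroup.t (i + (k : ZMod e)) : KGroup e k n) = x at *
  generalize (KGroup.t i : KGroup e k n) = t at *
  generalize (KGroup.t (i - (k : ZMod e)) : KGroup e k n) = u at *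
  generalize (KGroup.s j : KGroup e k n) = s at *
  calc t * u * s * (t * u) * s = x * t * s * (t * u) * s := by rw [hT]
    _ = x * (t * s * t) * u * s := by group
    _ = x * s * t * (s * u * s) := by rw [← ht]; group
    _ = x * s * (t * u) * s * u := by rw [hu]; group
    _ = (x * s * x) * t * s * u := by rw [← hT]; group
    _ = s * x * (s * t * s) * u := by rw [← hx]; group
    _ = s * (x * t) * s * (t * u) := by rw [ht]; group
    _ = s * (t * u) * s * (t * u) := by rw [hT]

/-- The homomorphism from the Artin group of type `B_{n-1}` to `B^{(k)}(e,e,n)` that sends `q_1`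
to `t̃_i t̃_{i-k}` and `q_j` to `s̃_{j+1}` for `j ≥ 2`. -/
def KGroup.ofArtinB (e k n : ℕ) (i : ZMod e) : ArtinGroupB (n - 1) →* KGroup e k n :=
  FracGroup.lift
    (fun j => if h : (j : ℕ) = 1 then KGroup.t i * KGroup.t (i - (k : ZMod e))
      else KGroup.s ⟨j + 1, by have := j.2; grind⟩)
    (by
      rintro _ _ (⟨⟨a, ha⟩, ⟨b, hb⟩, h, h'⟩ | ⟨⟨a, ha⟩, ⟨b, hb⟩, h, h'⟩ | ⟨⟨a, ha⟩, ⟨b, hb⟩, h⟩) <;>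
        simp only [map_mul, FreeMonoid.lift_eval_of]
      · obtain rfl : a = 1 := h
        obtain rfl : b = 2 := h'
        rw [dif_pos rfl, dif_neg (by simp)]
        exact KGroup.braid_four _ rfl i
      · dsimp only at h h'
        rw [dif_neg (by omega), dif_neg (by omega)]
        exact KGroup.s_braid _ _ (by simpa using h')
      · dsimp only at h
        rw [dif_neg (c := b = 1) (by grind)]
        by_cases ha1 : a = 1
        · rw [dif_pos ha1]
          have hb4 : 4 ≤ b + 1 := by omega
          rw [mul_assoc, ← KGroup.st_comm _ hb4, ← mul_assoc, ← KGroup.st_comm _ hb4, mul_assoc]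
        · rw [dif_neg ha1]
          exact KGroup.s_comm _ _ (by simpa using h))

theorem KGroup.ofArtinB_one (i : ZMod e) (j : Set.Icc 1 (n - 1)) (hj : (j : ℕ) = 1) :
    KGroup.ofArtinB e k n i (ArtinGroupB.q j) = KGroup.t i * KGroup.t (i - (k : ZMod e)) :=
  (FracGroup.lift_of _ _ _).trans (dif_pos hj)

theorem KGroup.ofArtinB_of_ne_one (i : ZMod e) (j : Set.Icc 1 (n - 1)) (hj : (j : ℕ) ≠ 1) :
    KGroup.ofArtinB e k n i (ArtinGroupB.q j) =
      KGroup.s ⟨j + 1, by have := j.2; grind⟩ :=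
  (FracGroup.lift_of _ _ _).trans (dif_neg hj)

/-- On the coset of index `0`, the Artin group of type `B_{n-1}` acts by left multiplication. -/
theorem KGroup.toPerm_ofArtinB_apply (i : ZMod e) (g h : ArtinGroupB (n - 1)) :
    KGroup.toPerm e k n (KGroup.ofArtinB e k n i g) (h, 0) = (g * h, 0) := by
  let H : Subgroup (ArtinGroupB (n - 1)) :=
    { carrier := {g | ∀ h, KGroup.toPerm e k n (KGroup.ofArtinB e k n i g) (h, 0) = (g * h, 0)}
      one_mem' := fun h => by simp
      mul_mem' := fun {a b} ha hb h => by
        rw [map_mul, map_mul, Equiv.Perm.mul_apply, hb, ha, mul_assoc]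
      inv_mem' := fun {a} ha h => by
        rw [map_inv, map_inv, Equiv.Perm.inv_eq_iff_eq, ha, mul_inv_cancel_left] }
  refine PresentedGroup.generated_by _ H (fun j h => ?_) g h
  change KGroup.toPerm e k n (KGroup.ofArtinB e k n i (ArtinGroupB.q j)) (h, 0) =
    (ArtinGroupB.q j * h, 0)
  have hj := Set.mem_Icc.1 j.2
  by_cases hj1 : (j : ℕ) = 1
  -- `q_1` acts as `σ_1²`: up to index `1` with no factor, then back down with the factor `twist q 1
  -- = q 1`.
  · rw [KGroup.ofArtinB_one i j hj1, map_mul, KGroup.toPerm_t, KGroup.toPerm_t,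
      Equiv.Perm.mul_apply, cosetPerm_up _ (by omega), cosetPerm_down _ (by omega),
      ← ArtinGroupB.gen_coe, hj1]
    rfl
  · rw [KGroup.ofArtinB_of_ne_one i j hj1, KGroup.toPerm_s,
      cosetPerm_of_add_one_lt _ (by simp; omega) (by simp; omega), ← ArtinGroupB.gen_coe]
    rfl

theorem KGroup.ofArtinB_injective (i : ZMod e) :
    Function.Injective (KGroup.ofArtinB e k n i) := by
  rw [injective_iff_map_eq_one]
  intro g hg
  have h := KGroup.toPerm_ofArtinB_apply (k := k) i g 1
  rw [hg, map_one] at h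
  simpa using (congrArg Prod.fst h).symm

end KGroupRelations

end GarsideB

theorem mainTheorem11 (e k n : ℕ) (hn : 2 ≤ n) (hk : 1 ≤ k) (hke : k < e) (i : ZMod e) :
    ∃ φ : GarsideB.ArtinGroupB (n - 1) →* GarsideB.KGroup e k n,
      φ (GarsideB.ArtinGroupB.q ⟨1, Set.mem_Icc.2 ⟨by omega, by omega⟩⟩) =
          GarsideB.KGroup.t i * GarsideB.KGroup.t (i - (k : ZMod e)) ∧
      (∀ (j : ℕ) (hj : 2 ≤ j) (hjn : j ≤ n - 1),
        φ (GarsideB.ArtinGroupB.q ⟨j, Set.mem_Icc.2 ⟨by omega, by omega⟩⟩) =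
          GarsideB.KGroup.s ⟨j + 1, Set.mem_Icc.2 ⟨by omega, by omega⟩⟩) ∧
      Function.Injective φ := by
  refine ⟨GarsideB.KGroup.ofArtinB e k n i, GarsideB.KGroup.ofArtinB_one i _ rfl,
    fun j hj hjn => ?_, GarsideB.KGroup.ofArtinB_injective i⟩
  exact GarsideB.KGroup.ofArtinB_of_ne_one i _ (show j ≠ 1 by omega)
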